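/- **Theorem 3.3.** Call a topological space almost discrete if it has exactly one nonisolated point. Let $(X_i)_{i\in I}$ be a countable family of almost discrete Tychonoff spaces and let $X=\prod_{i\in I}X_i$. Let $C_p(X)$ be the space of continuous functions $X\to\mathbb R$ with the topology of pointwise convergence. Then the following statements are equivalent: 1. $C_p(X)$ is a $\mu$-space, i.e. every set $A\subseteq C_p(X)$ on which all continuous functions $C_p(X)\to\mathbb R$ are bounded has compact closure in $C_p(X)$; 2. $C_p(X)$ is realcomplete, i.e. homeomorphic to a closed subspace of $\mathbb R^{\tau}$ for some $\tau$; 3. $X$ is a $\mu^\sharp_{pc}$-space: every pseudocompact subspace of $C_p(X)$ (one on which every continuous real-valued function is bounded) has compact closure in $C_p(X)$; 4. $X$ is a $\mu^\sharp_{rcc}$-space: every relatively countably compact $A\subseteq C_p(X)$ (every sequence in $A$ has a cluster point in $C_p(X)$) has compact closure in $C_p(X)$; 5. $X$ is a $\mu^\sharp_{cp}$-space: every countably pracompact $A\subseteq C_p(X)$ (some $D\subseteq A$ is dense in $A$ and every infinite subset of $D$ has a limit point in $A$) has compact closure in $C_p(X)$; 6. $X$ is weakly Grothendieck: every countably compact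 $A\subseteq C_p(X)$ (every sequence in $A$ has a cluster point in $A$) has compact closure in $C_p(X)$; 7. $t(X)=\omega$, where the tightness $t(X)$ is the least infinite cardinal $\tau$ such that whenever $x\in\overline A\subseteq X$ there is $B\subseteq A$ with $|B|\le\tau$ and $x\in\overline B$; 8. $t_{\mathbf R}(X)=\omega$, where the weak functional tightness $t_{\mathbf R}(X)$ is the least infinite cardinal $\tau$ such that a function $f:X\to\mathbb R$ is continuous as soon as for every $A\subseteq X$ with $|A|\le\tau$ there is a continuous $g:X\to\mathbb R$ with $g|_A=f|_A$; 9. $X$ is a weak $q$-space, in the following sense: for every $x\in X$, every $A\subseteq X$ with $x\in\overline A$ and every assignment of a neighbourhood $U_S$ of $x$ to each finite set $S\subseteq X$, there is a countable $B\subseteq A$ such that $\overline B\cap\bigcap\{U_S: S\subseteq B\text{ finite}\}\neq\emptyset$. -/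

import Mathlib

open Topology

namespace CpTheory

universe u

/-- Almost discrete: there is exactly one nonisolated point. -/
def AlmostDiscrete (X : Type u) [TopologicalSpace X] : Prop :=
  ∃! x : X, ¬ IsOpen ({x} : Set X)

/-- The space of continuous real-valued functions on `X` with the topology of pointwise
convergence, i.e. as a topological subspace of the power `X → ℝ`. -/
abbrev Cp (X : Type u) [TopologicalSpace X] : Type u :=
  {f : X → ℝ // Continuous f}

section Subsets

variable {Y : Type u} [TopologicalSpace Y]

/-- `A` has compact closure in `Y`. -/
def RelativelyCompact (A : Set Y) : Prop :=
  IsCompact (closure A)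

/-- Every continuous real-valued function on the whole space `Y` is bounded on `A`. -/
def BoundedSubset (A : Set Y) : Prop :=
  ∀ f : Y → ℝ, Continuous f → Bornology.IsBounded (f '' A)

/-- Every sequence in `A` has a limit (cluster) point in `A`. -/
def CountablyCompact (A : Set Y) : Prop :=
  ∀ a : ℕ → Y, (∀ n, a n ∈ A) → ∃ y ∈ A, MapClusterPt y Filter.atTop a

/-- Every sequence in `A` has a limit (cluster) point in `Y`. -/
def RelativelyCountablyCompact (A : Set Y) : Prop :=
  ∀ a : ℕ → Y, (∀ n, a n ∈ A) → ∃ y : Y, MapClusterPt y Filter.atTop a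

/-- Every continuous real-valued function on the subspace `A` is bounded. -/
def PseudocompactSubset (A : Set Y) : Prop :=
  ∀ f : A → ℝ, Continuous f → Bornology.IsBounded (Set.range f)

/-- Some `D ⊆ A` is dense in `A` and every infinite subset of `D` has a limit point in `A`. -/
def CountablyPracompact (A : Set Y) : Prop :=
  ∃ D ⊆ A, A ⊆ closure D ∧
    ∀ B ⊆ D, B.Infinite → ∃ y ∈ A, AccPt y (Filter.principal B)

end Subsets

/-- A μ-space: every bounded subset is relatively compact. -/
def MuSpace (Y : Type u) [TopologicalSpace Y] : Prop :=
  ∀ A : Set Y, BoundedSubset A → RelativelyCompact A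

/-- A g-space: every countably compact subset has compact closure. -/
def GSpace (Y : Type u) [TopologicalSpace Y] : Prop :=
  ∀ A : Set Y, CountablyCompact A → RelativelyCompact A

/-- Homeomorphic to a closed subspace of a power of the real line. (An index type in the
universe of `Y` is no restriction: a closed embedding into any power of `ℝ` makes the evaluation
map of `Y` into the power of `ℝ` indexed by all continuous functions a closed embedding.) -/
def Realcomplete (Y : Type u) [TopologicalSpace Y] : Prop :=
  ∃ (τ : Type u) (e : Y → (τ → ℝ)), IsClosedEmbedding e

/-- `X` is a μ♯-space for a family `P` of subsets of `Cp X`: every member of `P` is relatively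
compact in `Cp X`. -/
def MuSharp (X : Type u) [TopologicalSpace X] (P : Set (Set (Cp X))) : Prop :=
  ∀ A ∈ P, RelativelyCompact A

/-- Weakly Grothendieck: `Cp X` is a g-space. -/
def WeaklyGrothendieck (X : Type u) [TopologicalSpace X] : Prop :=
  GSpace (Cp X)

/-- The tightness of `X`: the least infinite cardinal `τ` such that every point in the closure
of a set `A` is in the closure of a subset of `A` of cardinality at most `τ`. -/
noncomputable def tightness (X : Type u) [TopologicalSpace X] : Cardinal.{u} :=
  sInf {τ | Cardinal.aleph0 ≤ τ ∧ ∀ (A : Set X), ∀ x ∈ closure A,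
    ∃ B ⊆ A, Cardinal.mk B ≤ τ ∧ x ∈ closure B}

/-- `f` is strictly `τ`-continuous: on every set of cardinality at most `τ` it coincides with a
continuous real-valued function on `X`. -/
def StrictlyContinuous {X : Type u} [TopologicalSpace X] (τ : Cardinal.{u}) (f : X → ℝ) : Prop :=
  ∀ A : Set X, Cardinal.mk A ≤ τ → ∃ g : X → ℝ, Continuous g ∧ Set.EqOn f g A

/-- The weak functional tightness of `X`: the least infinite cardinal `τ` such that every strictly
`τ`-continuous real-valued function on `X` is continuous. -/
noncomputable def weakFunctionalTightness (X : Type u) [TopologicalSpace X] : Cardinal.{u} :=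
  sInf {τ | Cardinal.aleph0 ≤ τ ∧ ∀ f : X → ℝ, StrictlyContinuous τ f → Continuous f}

/-- `x` is a weak q-point: whenever `x` is in the closure of `A` and a neighbourhood `U S` of `x`
is assigned to every finite set `S`, there is a countable `B ⊆ A` whose closure meets the
intersection of the neighbourhoods assigned to the finite subsets of `B`. -/
def WeakQPoint {X : Type u} [TopologicalSpace X] (x : X) : Prop :=
  ∀ A : Set X, x ∈ closure A → ∀ U : Finset X → Set X, (∀ S, U S ∈ 𝓝 x) →
    ∃ B ⊆ A, B.Countable ∧
      ∃ y ∈ closure B, ∀ S : Finset X, (S : Set X) ⊆ B → y ∈ U S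

/-- A weak q-space: every point is a weak q-point. -/
def WeakQSpace (X : Type u) [TopologicalSpace X] : Prop :=
  ∀ x : X, WeakQPoint x

end CpTheory

open CpTheory

open Filter Set

namespace CpTheory

universe u v

/-! ### Compactness-like conditions imply boundedness. -/

section Bounded

variable {Y : Type u} [TopologicalSpace Y]

/-! Only the passage from weakly Grothendieck to countable tightness uses the product of almost
discrete spaces; the other implications are general. Its engine is
`WeaklyGrothendieck.isClopen_preimage`: if all countable subsets of `D` have clopen preimages, then
so does `D`. If `x` is in the closure of `A` but of no countable subset of `A`, and `A` varies in
finitely many coordinates only, `A` can be trimmed to such a `D` with `x ∈ closure D \ D`, which is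
absurd (`exists_countable_of_eq_off_finset`). Countably many finite sets of coordinates then settle
the product. The way back is `realcomplete_of_strictlyContinuous`, or, for weak q-spaces,
`WeakQSpace.weaklyGrothendieck`. -/

lemma exists_seq_of_not_isBounded_image {Z : Type*} {f : Z → ℝ} {A : Set Z}
    (h : ¬ Bornology.IsBounded (f '' A)) : ∃ a : ℕ → Z, ∀ n, a n ∈ A ∧ (n : ℝ) < |f (a n)| := by
  simp only [isBounded_iff_forall_norm_le, not_exists, not_forall, forall_mem_image] at h
  choose a ha hlt using fun n : ℕ => h n
  exact ⟨a, fun n => ⟨ha n, by simpa using hlt n⟩⟩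

lemma not_mapClusterPt_of_unbounded {f : Y → ℝ} {y : Y} (hf : ContinuousAt f y) {a : ℕ → Y}
    (ha : ∀ n : ℕ, (n : ℝ) < |f (a n)|) : ¬ MapClusterPt y atTop a := by
  intro h
  have hU : ∀ᶠ z in 𝓝 y, |f z| < |f y| + 1 := hf.abs.eventually_lt_const (by linarith)
  obtain ⟨n, hn, hn'⟩ :=
    ((h.frequently hU).and_eventually (eventually_ge_atTop ⌈|f y| + 1⌉₊)).exists
  have := Nat.le_of_ceil_le hn'
  linarith [ha n]

lemma RelativelyCountablyCompact.boundedSubset {A : Set Y} (hA : RelativelyCountablyCompact A) :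
    BoundedSubset A := by
  intro f hf
  by_contra h
  obtain ⟨a, ha⟩ := exists_seq_of_not_isBounded_image h
  obtain ⟨y, hy⟩ := hA a fun n => (ha n).1
  exact not_mapClusterPt_of_unbounded hf.continuousAt (fun n => (ha n).2) hy

lemma PseudocompactSubset.boundedSubset {A : Set Y} (hA : PseudocompactSubset A) :
    BoundedSubset A := by
  intro f hf
  have := hA (fun a => f a) (hf.comp continuous_subtype_val)
  rwa [show range (fun a : A => f a) = f '' A by ext; simp] at this

lemma CountablyCompact.relativelyCountablyCompact {A : Set Y} (hA : CountablyCompact A) :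
    RelativelyCountablyCompact A := fun a ha => by
  obtain ⟨y, -, hy⟩ := hA a ha
  exact ⟨y, hy⟩

lemma CountablyCompact.pseudocompactSubset {A : Set Y} (hA : CountablyCompact A) :
    PseudocompactSubset A := by
  intro f hf
  rw [← image_univ]
  by_contra h
  obtain ⟨a, ha⟩ := exists_seq_of_not_isBounded_image h
  obtain ⟨y, hyA, hy⟩ := hA (fun n => a n) fun n => (a n).2
  refine not_mapClusterPt_of_unbounded (y := (⟨y, hyA⟩ : A)) hf.continuousAt
    (fun n => (ha n).2) ?_
  rw [mapClusterPt_iff_frequently] at hy ⊢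
  intro s hs
  obtain ⟨t, ht, hts⟩ := mem_nhds_subtype A _ s |>.1 hs
  exact (hy t ht).mono fun n hn => hts hn

lemma CountablyCompact.countablyPracompact {A : Set Y} (hA : CountablyCompact A) :
    CountablyPracompact A := by
  refine ⟨A, Subset.rfl, subset_closure, fun B hB hinf => ?_⟩
  have := hinf.to_subtype
  let a := Infinite.natEmbedding B
  obtain ⟨y, hyA, hy⟩ := hA (fun n => a n) fun n => hB (a n).2
  refine ⟨y, hyA, accPt_iff_nhds.2 fun U hU => ?_⟩
  have hinj : Function.Injective fun n => (a n : Y) := Subtype.val_injective.comp a.injective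
  have hfr := (mapClusterPt_iff_frequently.1 hy) U hU
  -- An injective sequence takes the value `y` at most once.
  have hne : ∀ᶠ n in atTop, (a n : Y) ≠ y := by
    rw [← Nat.cofinite_eq_atTop]
    exact hinj.tendsto_cofinite.eventually (eventually_cofinite_ne y)
  obtain ⟨n, hn, hn'⟩ := (hfr.and_eventually hne).exists
  exact ⟨a n, ⟨hn, (a n).2⟩, hn'⟩

lemma CountablyPracompact.boundedSubset [T1Space Y] {A : Set Y} (hA : CountablyPracompact A) :
    BoundedSubset A := by
  obtain ⟨D, -, hAD, hD⟩ := hA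
  intro f hf
  suffices h : Bornology.IsBounded (f '' D) from
    h.closure.subset ((image_mono hAD).trans (image_closure_subset_closure_image hf))
  by_contra h
  obtain ⟨a, ha⟩ := exists_seq_of_not_isBounded_image h
  have hinf : (range a).Infinite := by
    intro hfin
    obtain ⟨C, hC⟩ := isBounded_iff_forall_norm_le.1 (hfin.image f).isBounded
    have h1 := hC _ (mem_image_of_mem f (mem_range_self ⌈C⌉₊))
    have h2 := (ha ⌈C⌉₊).2
    rw [Real.norm_eq_abs] at h1
    linarith [Nat.le_ceil C]
  obtain ⟨y, -, hy⟩ := hD (range a) (by rintro _ ⟨n, rfl⟩; exact (ha n).1) hinf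
  refine not_mapClusterPt_of_unbounded hf.continuousAt (fun n => (ha n).2) (y := y) ?_
  rw [mapClusterPt_iff_frequently]
  intro s hs
  rw [← Nat.cofinite_eq_atTop, frequently_cofinite_iff_infinite]
  -- In a T1 space finitely many points other than `y` can be removed from a neighbourhood of `y`.
  have hy' : (s ∩ range a).Infinite := by
    intro hfin
    have hV : s ∩ ((s ∩ range a) \ {y})ᶜ ∈ 𝓝 y :=
      inter_mem hs ((hfin.subset sdiff_subset).isClosed.isOpen_compl.mem_nhds (by simp))
    obtain ⟨z, ⟨⟨hzs, hz⟩, hza⟩, hzy⟩ := accPt_iff_nhds.1 hy _ hV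
    exact hz ⟨⟨hzs, hza⟩, hzy⟩
  intro hfin
  refine hy' ((hfin.image a).subset ?_)
  rintro _ ⟨hz, n, rfl⟩
  exact ⟨n, hz, rfl⟩

end Bounded

lemma Realcomplete.muSpace {Y : Type u} [TopologicalSpace Y] (h : Realcomplete Y) :
    MuSpace Y := by
  obtain ⟨τ, e, he⟩ := h
  intro A hA
  have hbdd : ∀ t, Bornology.IsBounded ((fun y => e y t) '' A) := fun t =>
    hA _ ((continuous_apply t).comp he.continuous)
  have hK : IsCompact (univ.pi fun t => closure ((fun y => e y t) '' A)) :=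
    isCompact_univ_pi fun t => (hbdd t).isCompact_closure
  refine (he.isCompact_preimage hK).of_isClosed_subset isClosed_closure
    (closure_minimal (fun y hy => ?_) (hK.isClosed.preimage he.continuous))
  exact fun t _ => subset_closure ⟨y, hy, rfl⟩

lemma exists_finset_seq {Z : Type*} {B : Set Z} (hB : B.Countable) : ∃ S : ℕ → Finset Z,
    (∀ n, (S n : Set Z) ⊆ B) ∧ ∀ b ∈ B, ∀ᶠ n in atTop, b ∈ S n := by
  classical
  rcases B.eq_empty_or_nonempty with rfl | hne
  · exact ⟨fun _ => ∅, by simp, by simp⟩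
  obtain ⟨s, rfl⟩ := hB.exists_eq_range hne
  refine ⟨fun n => (Finset.range (n + 1)).image s, fun n => ?_, ?_⟩
  · intro y hy
    simp only [Finset.coe_image, mem_image] at hy
    obtain ⟨i, -, rfl⟩ := hy
    exact mem_range_self i
  · rintro _ ⟨i, rfl⟩
    filter_upwards [eventually_ge_atTop i] with n hn
    exact Finset.mem_image_of_mem s (Finset.mem_range.2 (by omega))

/-! ### Realcompleteness and compactness in `Cp X`. -/

section Cp

variable {X : Type u} [TopologicalSpace X]

lemma continuous_eval (x : X) : Continuous fun g : Cp X => g.1 x :=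
  (continuous_apply x).comp continuous_subtype_val

/-- `Cp X` embeds in the power of `ℝ` indexed by all its continuous functions. A limit `φ` of the
image induces `x ↦ φ (ev x)`, and closedness amounts to continuity of this function. -/
lemma realcomplete_of_strictlyContinuous
    (h : ∀ f : X → ℝ, StrictlyContinuous Cardinal.aleph0 f → Continuous f) :
    Realcomplete (Cp X) := by
  let ev : X → C(Cp X, ℝ) := fun x => ⟨fun g => g.1 x, continuous_eval x⟩
  let e : Cp X → C(Cp X, ℝ) → ℝ := fun g k => k g
  have he : Continuous e := continuous_pi fun k => k.continuous
  have hr : Continuous fun (φ : C(Cp X, ℝ) → ℝ) (x : X) => φ (ev x) :=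
    continuous_pi fun x => continuous_apply (ev x)
  refine ⟨C(Cp X, ℝ), e, IsEmbedding.of_comp he hr IsEmbedding.subtypeVal,
    isClosed_of_closure_subset fun φ hφ => ?_⟩
  let l := comap e (𝓝 φ)
  have hl : l.NeBot := comap_neBot_iff.2 fun t ht => by
    obtain ⟨_, hy, g, rfl⟩ := mem_closure_iff_nhds.1 hφ t ht
    exact ⟨g, hy⟩
  have hlim : ∀ k : C(Cp X, ℝ), Tendsto k l (𝓝 (φ k)) := fun k =>
    ((continuous_apply k).tendsto φ).comp tendsto_comap
  have hf : Continuous fun x => φ (ev x) := by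
    refine h _ fun A hA => ?_
    have : Countable A := Cardinal.mk_le_aleph0_iff.1 hA
    let := TopologicalSpace.metrizableSpaceMetric (A → ℝ)
    by_contra! hno
    let p : Cp X → A → ℝ := fun g a => g.1 a
    let q : A → ℝ := fun a => φ (ev a)
    have hp : Continuous p := continuous_pi fun a => continuous_eval (a : X)
    have hpq : ∀ g, dist (p g) q ≠ 0 := by
      intro g hg
      refine hno g.1 g.2 fun a ha => ?_
      exact (congrFun (dist_eq_zero.1 hg) ⟨a, ha⟩).symm
    -- If no `g` restricts to `q` on the countable set `A`, this is continuous; it would have to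
    -- blow up along `l`, yet it converges to `φ k`.
    let k : C(Cp X, ℝ) := ⟨fun g => (dist (p g) q)⁻¹, (hp.dist continuous_const).inv₀ hpq⟩
    have hpl : Tendsto p l (𝓝 q) := tendsto_pi_nhds.2 fun a => hlim (ev a)
    have hd : Tendsto (fun g => dist (p g) q * k g) l (𝓝 (0 * φ k)) := by
      refine Tendsto.mul ?_ (hlim k)
      simpa using hpl.dist (tendsto_const_nhds (x := q))
    have h1 : (fun g => dist (p g) q * k g) = fun _ => 1 := funext fun g => mul_inv_cancel₀ (hpq g)
    rw [h1, zero_mul] at hd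
    exact one_ne_zero (tendsto_nhds_unique tendsto_const_nhds hd)
  have hconv : Tendsto id l (𝓝 (⟨_, hf⟩ : Cp X)) :=
    tendsto_subtype_rng.2 (tendsto_pi_nhds.2 fun x => hlim (ev x))
  exact ⟨⟨_, hf⟩, funext fun k =>
    tendsto_nhds_unique ((k.continuous.tendsto _).comp hconv) (hlim k)⟩

lemma relativelyCompact_of_closure_image_subset {A : Set (Cp X)}
    (hb : ∀ x, Bornology.IsBounded ((fun g : Cp X => g.1 x) '' A))
    (hA : ∀ f ∈ closure (Subtype.val '' A), Continuous f) : RelativelyCompact A := by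
  have hK : IsCompact (univ.pi fun x => closure ((fun g : Cp X => g.1 x) '' A)) :=
    isCompact_univ_pi fun x => (hb x).isCompact_closure
  have hcl : IsCompact (closure (Subtype.val '' A) : Set (X → ℝ)) := by
    refine hK.of_isClosed_subset isClosed_closure (closure_minimal ?_ hK.isClosed)
    rintro _ ⟨g, hg, rfl⟩ x _
    exact subset_closure ⟨g, hg, rfl⟩
  have hval : IsInducing (Subtype.val : Cp X → X → ℝ) := IsInducing.subtypeVal
  rw [RelativelyCompact, hval.closure_eq_preimage_closure_image, hval.isCompact_iff,
    image_preimage_eq_of_subset]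
  · exact hcl
  · intro f hf
    exact ⟨⟨f, hA f hf⟩, rfl⟩

lemma MapClusterPt.exists_ultrafilter_eval {a : ℕ → Cp X} {g : Cp X}
    (h : MapClusterPt g atTop a) : ∃ l : Ultrafilter ℕ, (l : Filter ℕ) ≤ atTop ∧
      ∀ x, Tendsto (fun n => (a n).1 x) l (𝓝 (g.1 x)) := by
  obtain ⟨l, hl, ha⟩ := mapClusterPt_iff_ultrafilter.1 h
  exact ⟨l, hl, fun x => ((continuous_eval x).tendsto g).comp ha⟩

/-- A discontinuous pointwise limit `f` of `A` is approximated on finite sets by members of `A`. A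
cluster point `k` of countably many of these is continuous, yet inherits the jump of `f` on `B` and
not at `y ∈ closure B`. -/
lemma WeakQSpace.weaklyGrothendieck (hX : WeakQSpace X) : WeaklyGrothendieck X := by
  intro A hA
  refine relativelyCompact_of_closure_image_subset
    (fun x => hA.relativelyCountablyCompact.boundedSubset _ (continuous_eval x)) fun f hf => ?_
  rw [continuous_iff_continuousAt]
  intro x
  by_contra hx
  obtain ⟨ε, hε, hfr⟩ : ∃ ε > 0, ∃ᶠ y in 𝓝 x, ε ≤ dist (f y) (f x) := by
    simpa [ContinuousAt, Metric.tendsto_nhds] using hx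
  have happrox : ∀ S : Finset X, ∃ g ∈ A, ∀ y ∈ insert x (S : Set X),
      dist (g.1 y) (f y) < ε / 4 := by
    intro S
    have hU : (insert x (S : Set X)).pi (fun y => Metric.ball (f y) (ε / 4)) ∈ 𝓝 f :=
      set_pi_mem_nhds (S.finite_toSet.insert x) fun y _ => Metric.ball_mem_nhds _ (by positivity)
    obtain ⟨_, hg, g, hgA, rfl⟩ := mem_closure_iff_nhds.1 hf _ hU
    exact ⟨g, hgA, fun y hy => hg y hy⟩
  choose g hgA hg using happrox
  obtain ⟨B, hBA, hBc, y, hyB, hyU⟩ := hX x {y | ε ≤ dist (f y) (f x)}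
    (mem_closure_iff_frequently.2 hfr) (fun S => {y | dist ((g S).1 y) ((g S).1 x) < ε / 4})
    (fun S => (g S).2.continuousAt.eventually (Metric.ball_mem_nhds _ (by positivity)))
  obtain ⟨S, hSB, hS⟩ := exists_finset_seq hBc
  obtain ⟨k, -, hk⟩ := hA (fun n => g (S n)) fun n => hgA _
  obtain ⟨l, hl, hlim⟩ := MapClusterPt.exists_ultrafilter_eval hk
  have hkx : dist (k.1 x) (f x) ≤ ε / 4 :=
    le_of_tendsto ((hlim x).dist tendsto_const_nhds)
      (Eventually.of_forall fun n => (hg (S n) x (mem_insert _ _)).le)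
  have hky : dist (k.1 y) (k.1 x) ≤ ε / 4 :=
    le_of_tendsto ((hlim y).dist (hlim x)) (Eventually.of_forall fun n => (hyU _ (hSB n)).le)
  -- The jump `ε` of `f` loses `ε / 4` at each of `b` and `x`; what remains still exceeds the `ε /
  -- 4` of `hky`.
  have hkB : ∀ b ∈ B, ε / 2 ≤ dist (k.1 b) (k.1 x) := by
    intro b hb
    have h1 : dist (k.1 b) (f b) ≤ ε / 4 :=
      le_of_tendsto ((hlim b).dist tendsto_const_nhds)
        (hl ((hS b hb).mono fun n hn => (hg (S n) b (mem_insert_of_mem _ hn)).le))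
    have h2 : ε ≤ dist (f b) (f x) := hBA hb
    have h3 := dist_triangle4 (f b) (k.1 b) (k.1 x) (f x)
    rw [dist_comm (f b) (k.1 b)] at h3
    linarith
  have : ε / 2 ≤ dist (k.1 y) (k.1 x) :=
    (isClosed_le continuous_const (k.2.dist continuous_const)).closure_subset_iff.2 hkB hyB
  linarith

end Cp


/-! ### Countable tightness and clopen preimages. -/

section Tightness

variable {X : Type u} [TopologicalSpace X]

/-- Every point in the closure of a set is in the closure of a countable subset of it. -/
def CountablyTight (X : Type u) [TopologicalSpace X] : Prop :=
  ∀ A : Set X, ∀ x ∈ closure A, ∃ B ⊆ A, B.Countable ∧ x ∈ closure B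

lemma sInf_eq_aleph0_iff {P : Cardinal.{u} → Prop} :
    sInf {τ | Cardinal.aleph0 ≤ τ ∧ P τ} = Cardinal.aleph0 ↔ P Cardinal.aleph0 := by
  constructor
  · intro h
    -- The infimum of the empty set of cardinals is `0`.
    have hne : {τ | Cardinal.aleph0 ≤ τ ∧ P τ}.Nonempty := by
      rw [nonempty_iff_ne_empty]
      intro h0
      rw [h0, Cardinal.sInf_empty] at h
      exact Cardinal.aleph0_ne_zero h.symm
    have := csInf_mem hne
    rw [h] at this
    exact this.2
  · intro h
    exact le_antisymm (csInf_le' ⟨le_rfl, h⟩) (le_csInf ⟨_, le_rfl, h⟩ fun τ hτ => hτ.1)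

lemma tightness_eq_aleph0_iff : tightness X = Cardinal.aleph0 ↔ CountablyTight X := by
  simp only [tightness, sInf_eq_aleph0_iff, Cardinal.le_aleph0_iff_set_countable, CountablyTight]

lemma CountablyTight.continuous_of_strictlyContinuous (hX : CountablyTight X) {f : X → ℝ}
    (hf : StrictlyContinuous Cardinal.aleph0 f) : Continuous f := by
  rw [continuous_iff_isClosed]
  intro C hC
  refine isClosed_of_closure_subset fun x hx => ?_
  obtain ⟨B, hBC, hB, hxB⟩ := hX _ x hx
  obtain ⟨g, hg, hfg⟩ := hf (insert x B)
    (Cardinal.le_aleph0_iff_set_countable.2 (hB.insert x))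
  have hsub : B ⊆ g ⁻¹' C := fun b hb => by
    rw [mem_preimage, ← hfg (mem_insert_of_mem x hb)]
    exact hBC hb
  have := closure_minimal hsub (hC.preimage hg) hxB
  rwa [mem_preimage, ← hfg (mem_insert x B)] at this

lemma CountablyTight.weakQSpace (hX : CountablyTight X) : WeakQSpace X := by
  intro x A hx U hU
  obtain ⟨B, hBA, hB, hxB⟩ := hX A x hx
  exact ⟨B, hBA, hB, x, hxB, fun S _ => mem_of_mem_nhds (hU S)⟩

/-- If the preimage of every countable subset of `D` under `r` is clopen, then the indicators
of these preimages form a countably compact set of functions. -/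
lemma WeaklyGrothendieck.isClopen_preimage (hX : WeaklyGrothendieck X) (r : X → X) (D : Set X)
    (hD : ∀ B ⊆ D, B.Countable → IsClopen (r ⁻¹' B)) : IsClopen (r ⁻¹' D) := by
  let χ : Set X → X → ℝ := fun B => (r ⁻¹' B).indicator 1
  let K : Set (Cp X) := {g | ∃ B ⊆ D, B.Countable ∧ g.1 = χ B}
  have hχ : ∀ B ⊆ D, B.Countable → Continuous (χ B) := fun B hB hBc =>
    continuous_one.indicator fun a ha => by simp [(hD B hB hBc).frontier_eq] at ha
  have hK : CountablyCompact K := by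
    intro a ha
    choose B hBD hBc hB using ha
    -- The ultrafilter limit of the `B n` lies in their union, hence is again countable.
    let C : Set X := {y | ∀ᶠ n in (hyperfilter ℕ : Filter ℕ), y ∈ B n}
    have hCB : C ⊆ ⋃ n, B n := fun y hy => mem_iUnion.2 hy.exists
    have hCD : C ⊆ D := hCB.trans (iUnion_subset hBD)
    have hCc : C.Countable := (countable_iUnion hBc).mono hCB
    refine ⟨⟨χ C, hχ C hCD hCc⟩, ⟨C, hCD, hCc, rfl⟩, ?_⟩
    suffices h : Tendsto a (hyperfilter ℕ) (𝓝 (⟨χ C, hχ C hCD hCc⟩ : Cp X)) from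
      h.mapClusterPt.mono Nat.hyperfilter_le_atTop
    refine tendsto_subtype_rng.2 (tendsto_pi_nhds.2 fun y => ?_)
    by_cases hy : r y ∈ C
    · refine tendsto_const_nhds.congr' ((show ∀ᶠ n in _, r y ∈ B n from hy).mono fun n hn => ?_)
      simp only [hB n]
      simp [χ, hy, hn]
    · have hy' : ∀ᶠ n in (hyperfilter ℕ : Filter ℕ), r y ∉ B n :=
        Ultrafilter.eventually_not.2 hy
      refine tendsto_const_nhds.congr' (hy'.mono fun n hn => ?_)
      simp only [hB n]
      simp [χ, hy, hn]
  have hcl : IsClosed (Subtype.val '' closure K : Set (X → ℝ)) :=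
    ((hX K hK).image continuous_subtype_val).isClosed
  have hmem : χ D ∈ (Subtype.val '' closure K : Set (X → ℝ)) := by
    rw [← hcl.closure_eq, mem_closure_iff_nhds]
    intro U hU
    rw [nhds_pi, Filter.mem_pi] at hU
    obtain ⟨I, hI, t, ht, htU⟩ := hU
    -- A basic neighbourhood tests finitely many points, where a finite part of `D` gives the same
    -- indicator.
    have hBD : D ∩ r '' I ⊆ D := inter_subset_left
    have hBc : (D ∩ r '' I).Countable := (hI.image r).countable.mono inter_subset_right
    refine ⟨χ (D ∩ r '' I), htU fun i hi => ?_, ⟨_, hχ _ hBD hBc⟩,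
      subset_closure ⟨_, hBD, hBc, rfl⟩, rfl⟩
    have : χ (D ∩ r '' I) i = χ D i := by
      have hri : r i ∈ r '' I := mem_image_of_mem r hi
      by_cases hy : r i ∈ D <;> simp [χ, hy, hri, -mem_image]
    rw [this]
    exact mem_of_mem_nhds (ht i)
  obtain ⟨g, -, hg⟩ := hmem
  have hc : Continuous (χ D) := hg ▸ g.2
  have h1 : r ⁻¹' D = χ D ⁻¹' {0}ᶜ := by ext y; simp [χ]
  have h2 : r ⁻¹' D = χ D ⁻¹' {1} := by
    ext y
    by_cases hy : r y ∈ D <;> simp [χ, hy]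
  exact ⟨h2 ▸ isClosed_singleton.preimage hc, h1 ▸ isClosed_singleton.isOpen_compl.preimage hc⟩

end Tightness

/-! ### Countable tightness of the product. -/

section Product

variable {ι : Type u} {X : ι → Type v} [∀ i, TopologicalSpace (X i)]

lemma AlmostDiscrete.isOpen_singleton {Z : Type u} [TopologicalSpace Z] (hZ : AlmostDiscrete Z)
    {x z : Z} (hx : ¬ IsOpen {x}) (hz : z ≠ x) : IsOpen {z} := by
  by_contra h
  exact hz (hZ.unique h hx)

lemma exists_countable_of_eq_off_finset [∀ i, T3Space (X i)] (hX : ∀ i, AlmostDiscrete (X i))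
    (hG : WeaklyGrothendieck (∀ i, X i)) (T : Finset ι) :
    ∀ (A : Set (∀ i, X i)) (x : ∀ i, X i), (∀ y ∈ A, ∀ i ∉ T, y i = x i) → x ∈ closure A →
      ∃ B ⊆ A, B.Countable ∧ x ∈ closure B := by
  classical
  induction T using Finset.strongInduction with
  | H T ih =>
  intro A x hAT hx
  by_contra! hno
  have hxA : x ∉ A := fun h => hno {x} (singleton_subset_iff.2 h) (countable_singleton x)
    (subset_closure rfl)
  have eq_off : ∀ {S : Set (∀ i, X i)} {z : ∀ i, X i}, S ⊆ A → z ∈ closure S →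
      ∀ i ∉ T, z i = x i := fun hS hz i hi =>
    closure_minimal (fun y hy => hAT y (hS hy) i hi)
      (isClosed_eq (continuous_apply i) continuous_const) hz
  -- points of `closure A` having a coordinate in `T` fixed are handled by induction
  have step : ∀ i ∈ T, ∀ (S : Set (∀ i, X i)) (z : ∀ i, X i), (∀ y ∈ S, ∀ j ∉ T, y j = z j) →
      z ∈ closure {y ∈ S | y i = z i} → ∃ B ⊆ S, B.Countable ∧ z ∈ closure B := by
    intro i hi S z hS hz
    obtain ⟨B, hB, hBc, hzB⟩ := ih (T.erase i) (Finset.erase_ssubset hi) _ z (fun y hy j hj => by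
      by_cases hji : j = i
      · subst hji; exact hy.2
      · exact hS y hy.1 j fun hjT => hj (Finset.mem_erase.2 ⟨hji, hjT⟩)) hz
    exact ⟨B, hB.trans (sep_subset _ _), hBc, hzB⟩
  -- Near `z` the `i`-th coordinate is constant, so it counts as fixed.
  have isolated_step : ∀ i ∈ T, ∀ (S : Set (∀ i, X i)) (z : ∀ i, X i),
      (∀ y ∈ S, ∀ j ∉ T, y j = z j) → IsOpen {z i} → z ∈ closure S →
      ∃ B ⊆ S, B.Countable ∧ z ∈ closure B := by
    intro i hi S z hS hzi hz
    refine step i hi S z hS ?_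
    have hzS : z ∈ (fun y : ∀ j, X j => y i) ⁻¹' {z i} ∩ closure S := ⟨rfl, hz⟩
    have hzS' := (hzi.preimage (continuous_apply i)).inter_closure hzS
    rwa [inter_comm] at hzS'
  have hxT : ∀ i ∈ T, ¬ IsOpen {x i} := by
    intro i hi ho
    obtain ⟨B, hB, hBc, hxB⟩ := isolated_step i hi A x hAT ho hx
    exact hno B hB hBc hxB
  let A₀ : Set (∀ i, X i) := {y ∈ A | ∀ i ∈ T, y i ≠ x i}
  have hA₀ : A₀ ⊆ A := sep_subset _ _
  have hxA₀ : x ∈ closure A₀ := by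
    have hsub : A ⊆ A₀ ∪ ⋃ i ∈ T, {y ∈ A | y i = x i} := by
      intro y hy
      by_cases h : ∀ i ∈ T, y i ≠ x i
      · exact Or.inl ⟨hy, h⟩
      · push Not at h
        obtain ⟨i, hi, hyi⟩ := h
        exact Or.inr (mem_biUnion hi ⟨hy, hyi⟩)
    have := closure_mono hsub hx
    rw [closure_union, Finset.closure_biUnion] at this
    refine this.resolve_right fun h => ?_
    obtain ⟨i, hi, hxi⟩ := mem_iUnion₂.1 h
    obtain ⟨B, hB, hBc, hxB⟩ := step i hi A x hAT hxi
    exact hno B hB hBc hxB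
  let C : ι → Set (∀ i, X i) := fun i => {z ∈ closure A₀ | z ≠ x ∧ z i = x i}
  -- Otherwise countably many points of `C i` accumulate at `x`. Each differs from `x` in a
  -- coordinate, which is then isolated, so it is reached by a countable part of `A₀`; the union of
  -- these parts would reach `x`.
  have hxC : ∀ i ∈ T, x ∉ closure (C i) := by
    intro i hi hxi
    obtain ⟨C', hC', hC'c, hxC'⟩ := step i hi (C i) x (fun z hz => eq_off hA₀ hz.1)
      (by rwa [sep_eq_self_iff_mem_true.2 fun z hz => hz.2.2])
    have hcov : ∀ z ∈ C', ∃ B ⊆ A₀, B.Countable ∧ z ∈ closure B := by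
      intro z hz
      obtain ⟨hzA, hzx, -⟩ := hC' hz
      obtain ⟨j, hj⟩ := Function.ne_iff.1 hzx
      have hjT : j ∈ T := by
        by_contra hjT
        exact hj (eq_off hA₀ hzA j hjT)
      refine isolated_step j hjT A₀ z (fun y hy m hm => ?_)
        ((hX j).isOpen_singleton (hxT j hjT) hj) hzA
      rw [hAT y hy.1 m hm, eq_off hA₀ hzA m hm]
    choose! B hB hBc hzB using hcov
    refine hno (⋃ z ∈ C', B z) (iUnion₂_subset fun z hz => (hB z hz).trans hA₀)
      (hC'c.biUnion hBc) (closure_minimal (fun z hz => ?_) isClosed_closure hxC')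
    exact closure_mono (subset_biUnion_of_mem (u := B) hz) (hzB z hz)
  obtain ⟨V, hVx, hVcl, hV⟩ : ∃ V ∈ 𝓝 x, IsClosed V ∧ V ⊆ (⋃ i ∈ T, closure (C i))ᶜ := by
    refine exists_mem_nhds_isClosed_subset (IsOpen.mem_nhds ?_ ?_)
    · rw [← Finset.closure_biUnion]
      exact isClosed_closure.isOpen_compl
    · simpa using hxC
  have hxD : x ∈ closure (A₀ ∩ V) := by
    rw [mem_closure_iff_nhds] at hxA₀ ⊢
    intro U hU
    obtain ⟨y, ⟨hyU, hyV⟩, hyA⟩ := hxA₀ _ (inter_mem hU hVx)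
    exact ⟨y, hyU, hyA, hyV⟩
  let r : (∀ i, X i) → ∀ i, X i := fun y i => if i ∈ T then y i else x i
  have hr : Continuous r := continuous_pi fun i => by
    by_cases hi : i ∈ T
    · simpa [r, hi] using continuous_apply i
    · simpa [r, hi] using continuous_const
  have r_eq : ∀ y, (∀ i ∉ T, y i = x i) → r y = y := fun y hy => funext fun i => by
    by_cases hi : i ∈ T
    · simp [r, hi]
    · simp [r, hi, hy i hi]
  have hopen : ∀ z : ∀ i, X i, (∀ i ∈ T, z i ≠ x i) → (T : Set ι).pi (fun i => {z i}) ∈ 𝓝 z :=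
    fun z hz => set_pi_mem_nhds T.finite_toSet fun i hi =>
      ((hX i).isOpen_singleton (hxT i hi) (hz i hi)).mem_nhds rfl
  -- Limit points of `B` lie in `V` and are not `x`, so all their `T`-coordinates are isolated;
  -- hence they belong to `B`.
  have hclopen : ∀ B ⊆ A₀ ∩ V, B.Countable → IsClopen (r ⁻¹' B) := by
    intro B hB hBc
    refine ⟨IsClosed.preimage hr (isClosed_of_closure_subset fun z hz => ?_), ?_⟩
    · have hBA : B ⊆ A₀ := hB.trans inter_subset_left
      have hzx : z ≠ x := by
        rintro rfl
        exact hno B (hBA.trans hA₀) hBc hz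
      have hzV : z ∈ V := closure_minimal (hB.trans inter_subset_right) hVcl hz
      have hzT : ∀ i ∈ T, z i ≠ x i := fun i hi hzi =>
        hV hzV (mem_biUnion hi (subset_closure ⟨closure_mono hBA hz, hzx, hzi⟩))
      obtain ⟨y, hyz, hyB⟩ := mem_closure_iff_nhds.1 hz _ (hopen z hzT)
      have : y = z := funext fun i => by
        by_cases hi : i ∈ T
        · exact hyz i hi
        · rw [hAT y (hA₀ (hBA hyB)) i hi, eq_off (hBA.trans hA₀) hz i hi]
      exact this ▸ hyB
    · rw [isOpen_iff_mem_nhds]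
      intro y hy
      have hyT : ∀ i ∈ T, y i ≠ x i := fun i hi => by
        have := (hB hy).1.2 i hi
        simpa [r, hi] using this
      filter_upwards [hopen y hyT] with y' hy'
      have : r y' = r y := funext fun i => by
        by_cases hi : i ∈ T
        · simpa [r, hi] using hy' i hi
        · simp [r, hi]
      rwa [mem_preimage, this]
  have hD := (hG.isClopen_preimage r (A₀ ∩ V) hclopen).isClosed
  have hsub : A₀ ∩ V ⊆ r ⁻¹' (A₀ ∩ V) := fun y hy => by
    rwa [mem_preimage, r_eq y (hAT y hy.1.1)]
  have hxr : r x ∈ A₀ ∩ V := closure_minimal hsub hD hxD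
  rw [r_eq x fun _ _ => rfl] at hxr
  exact hxA hxr.1.1

lemma WeaklyGrothendieck.countablyTight_pi [Countable ι] [∀ i, T3Space (X i)]
    (hX : ∀ i, AlmostDiscrete (X i)) (hG : WeaklyGrothendieck (∀ i, X i)) :
    CountablyTight (∀ i, X i) := by
  classical
  intro A x hx
  let r : Finset ι → (∀ i, X i) → ∀ i, X i := fun T y i => if i ∈ T then y i else x i
  have hr : ∀ T, Continuous (r T) := fun T => continuous_pi fun i => by
    by_cases hi : i ∈ T
    · simpa [r, hi] using continuous_apply i
    · simpa [r, hi] using continuous_const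
  have key : ∀ T : Finset ι, ∃ B ⊆ A, B.Countable ∧ x ∈ closure (r T '' B) := by
    intro T
    have hrx : r T x = x := funext fun i => by simp [r]
    have hxr : x ∈ closure (r T '' A) := by
      have := image_closure_subset_closure_image (hr T) (mem_image_of_mem (r T) hx)
      rwa [hrx] at this
    obtain ⟨B', hB', hB'c, hxB'⟩ := exists_countable_of_eq_off_finset hX hG T (r T '' A) x
      (by rintro _ ⟨y, -, rfl⟩ i hi; simp [r, hi]) hxr
    have hpre : ∀ z ∈ B', ∃ y ∈ A, r T y = z := fun z hz => hB' hz
    choose! s hsA hs using hpre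
    refine ⟨s '' B', image_subset_iff.2 fun z hz => hsA z hz, hB'c.image s, closure_mono (fun z hz => ?_) hxB'⟩
    exact ⟨s z, mem_image_of_mem s hz, hs z hz⟩
  choose B hBA hBc hxB using key
  -- A basic neighbourhood of `x` restricts a finite set `I` of coordinates, on which `r I` changes
  -- nothing.
  refine ⟨⋃ T, B T, iUnion_subset hBA, countable_iUnion hBc, ?_⟩
  rw [mem_closure_iff_nhds]
  intro U hU
  rw [nhds_pi, Filter.mem_pi] at hU
  obtain ⟨I, hI, t, ht, htU⟩ := hU
  obtain ⟨_, hy, y, hyB, rfl⟩ := mem_closure_iff_nhds.1 (hxB hI.toFinset) _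
    (set_pi_mem_nhds hI fun i _ => ht i)
  refine ⟨y, htU fun i hi => ?_, mem_iUnion_of_mem _ hyB⟩
  simpa [r, hi] using hy i hi

end Product

end CpTheory

open CpTheory
theorem theorem3p3 {ι : Type*} [Countable ι] (X : ι → Type*)
    [∀ i, TopologicalSpace (X i)] [∀ i, T35Space (X i)] (hX : ∀ i, AlmostDiscrete (X i)) :
    [MuSpace (Cp (∀ i, X i)),
     Realcomplete (Cp (∀ i, X i)),
     MuSharp (∀ i, X i) {A | PseudocompactSubset A},
     MuSharp (∀ i, X i) {A | RelativelyCountablyCompact A},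
     MuSharp (∀ i, X i) {A | CountablyPracompact A},
     WeaklyGrothendieck (∀ i, X i),
     tightness (∀ i, X i) = Cardinal.aleph0,
     weakFunctionalTightness (∀ i, X i) = Cardinal.aleph0,
     WeakQSpace (∀ i, X i)].TFAE := by
  rw [tightness_eq_aleph0_iff, weakFunctionalTightness, sInf_eq_aleph0_iff]
  tfae_have 7 → 8 := fun h f hf => h.continuous_of_strictlyContinuous hf
  tfae_have 8 → 2 := realcomplete_of_strictlyContinuous
  tfae_have 2 → 1 := Realcomplete.muSpace
  tfae_have 1 → 3 := fun h A hA => h A (PseudocompactSubset.boundedSubset hA)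
  tfae_have 1 → 4 := fun h A hA => h A (RelativelyCountablyCompact.boundedSubset hA)
  tfae_have 1 → 5 := fun h A hA => h A (CountablyPracompact.boundedSubset hA)
  tfae_have 3 → 6 := fun h A hA => h A hA.pseudocompactSubset
  tfae_have 4 → 6 := fun h A hA => h A hA.relativelyCountablyCompact
  tfae_have 5 → 6 := fun h A hA => h A hA.countablyPracompact
  tfae_have 6 → 7 := fun h => h.countablyTight_pi hX
  tfae_have 7 → 9 := CountablyTight.weakQSpace
  tfae_have 9 → 6 := WeakQSpace.weaklyGrothendieck
  tfae_finish
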